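/- Let $Z\subseteq\mathbb R^d$ be closed, $p\in[1,\infty)$, $\varepsilon\in[0,1)$, $\rho,\sigma\in\mathbb R$, $z_0\in\mathbb R^d$, and let $\tilde\mu_n=\frac1n\sum_{i=1}^n\delta_{\tilde Z_i}$ be the empirical measure of $n\ge 1$ points $\tilde Z_1,\dots,\tilde Z_n\in Z$. Let $\mathcal P(Z)$ be the set of Borel probability measures on $Z$, and for $\mu,\nu\in\mathcal P(Z)$ put $$\mathsf W_p^\varepsilon(\mu\|\nu):=\inf\Big\{\mathsf W_p(\mu',\nu):\ \mu'\in\mathcal P(Z),\ \mu'\le\tfrac1{1-\varepsilon}\mu\Big\},\qquad \mathsf W_p(\mu',\nu):=\inf_{\pi}\big(\mathbb E_\pi\|X-Y\|^p\big)^{1/p}\in[0,\infty],$$ where $\pi$ runs over the couplings of $\mu'$ and $\nu$, and $$\mathcal G_{\rm cov}(\sigma,z_0):=\big\{\nu\in\mathcal P(Z):\ \nu \text{ has finite second moments and } \mathbb E_\nu[(X-z_0)(X-z_0)^\top]\preceq\sigma^2 I_d\big\}.$$ Assume the Slater condition: $\rho>0$, and there is $\nu_0\in\mathcal P(Z)$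 with finite second moments such that $\mathsf W_p^\varepsilon(\tilde\mu_n\|\nu_0)<\rho$ and $\mathbb E_{\nu_0}[(X-z_0)(X-z_0)^\top]\prec\sigma^2 I_d$. Then for every lower semicontinuous $\ell:Z\to\mathbb R$ with $\sup_{z\in Z}\frac{\ell(z)}{1+\|z\|^p}<\infty$, $$\sup_{\substack{\nu\in\mathcal G_{\rm cov}(\sigma,z_0)\\ \mathsf W_p^\varepsilon(\tilde\mu_n\|\nu)\le\rho}}\mathbb E_\nu[\ell]\;=\;\inf_{\Lambda_1\succeq0,\ \lambda_2\ge0,\ \alpha\in\mathbb R}\ -z_0^\top\Lambda_1z_0+\sigma^2\operatorname{Tr}\Lambda_1+\lambda_2\rho^p+\alpha+\frac1{1-\varepsilon}\,\mathbb E_{\tilde\mu_n}\big[\overline\ell(\cdot\,;\Lambda_1,\lambda_2,\alpha)\big],$$ where $\Lambda_1$ ranges over the symmetric positive semidefinite real $d\times d$ matrices and $$\overline\ell(z;\Lambda_1,\lambda_2,\alpha):=\sup_{\xi\in Z}\big[\ell(\xi)-\xi^\top\Lambda_1\xi+2\,\xi^\top\Lambda_1z_0-\lambda_2\|\xi-z\|^p-\alpha\big]_+\in[0,\infty],\qquad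 [t]_+:=\max\{t,0\}.$$ On the left, $\mathbb E_\nu[\ell]=\mathbb E_\nu[\ell_+]-\mathbb E_\nu[\ell_-]\in[-\infty,\infty)$, where $\ell_+=\max\{\ell,0\}$ and $\ell_-=\max\{-\ell,0\}$. -/

import Mathlib

open MeasureTheory
open scoped ENNReal Matrix

namespace OutlierRobust

noncomputable section

/-- Expectation `E_ν[f]` in `[-∞, ∞]` of a real function: the integral of the positive part minus
the integral of the negative part (meaningful as soon as one of the two is finite). -/
def expect {Ω : Type*} [MeasurableSpace Ω] (ν : Measure Ω) (f : Ω → ℝ) : EReal :=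
  ((∫⁻ z, ENNReal.ofReal (f z) ∂ν : ℝ≥0∞) : EReal) -
    ((∫⁻ z, ENNReal.ofReal (-f z) ∂ν : ℝ≥0∞) : EReal)

variable {d : ℕ} {Z : Set (EuclideanSpace ℝ (Fin d))}

/-- The empirical measure `(1/n) ∑ᵢ δ_{Zᵢ}` of `n` points of `Z`. -/
def empirical {n : ℕ} (pts : Fin n → Z) : Measure Z :=
  (n : ℝ≥0∞)⁻¹ • ∑ i, Measure.dirac (pts i)

/-- The couplings of two measures on `Z`. -/
def couplings (μ ν : Measure Z) : Set (Measure (Z × Z)) :=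
  {π | π.map Prod.fst = μ ∧ π.map Prod.snd = ν}

/-- The `p`-Wasserstein distance `inf_π (E_π ‖X - Y‖^p)^{1/p}`, with values in `[0, ∞]`. -/
def wasserstein (p : ℝ) (μ ν : Measure Z) : ℝ≥0∞ :=
  ⨅ π ∈ couplings μ ν,
    (∫⁻ w, ENNReal.ofReal (‖(w.1 : EuclideanSpace ℝ (Fin d)) - w.2‖ ^ p) ∂π) ^ (1 / p)

/-- The one-sided outlier-robust distance `W_p^ε(μ‖ν)`: the infimum of `W_p(μ', ν)` over the
probability measures `μ' ≤ μ / (1 - ε)`. -/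
def robustWasserstein (p ε : ℝ) (μ ν : Measure Z) : ℝ≥0∞ :=
  ⨅ μ' ∈ {μ' : Measure Z | IsProbabilityMeasure μ' ∧ μ' ≤ ENNReal.ofReal (1 / (1 - ε)) • μ},
    wasserstein p μ' ν

/-- The measure has finite second moments. -/
def FiniteSecondMoment (ν : Measure Z) : Prop :=
  MemLp (fun z : Z => (z : EuclideanSpace ℝ (Fin d))) 2 ν

/-- The matrix `E_ν[(X - z₀)(X - z₀)ᵀ]` (meaningful when second moments are finite). -/
def secondMoment (z₀ : EuclideanSpace ℝ (Fin d)) (ν : Measure Z) : Matrix (Fin d) (Fin d) ℝ :=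
  Matrix.of fun i j =>
    ∫ z : Z, ((z : EuclideanSpace ℝ (Fin d)) i - z₀ i) *
      ((z : EuclideanSpace ℝ (Fin d)) j - z₀ j) ∂ν

/-- The class `G_cov(σ, z₀)` of probability measures on `Z` with
`E_ν[(X - z₀)(X - z₀)ᵀ] ⪯ σ² I`. -/
def Gcov (Z : Set (EuclideanSpace ℝ (Fin d))) (σ : ℝ) (z₀ : EuclideanSpace ℝ (Fin d)) :
    Set (Measure Z) :=
  {ν | IsProbabilityMeasure ν ∧ FiniteSecondMoment ν ∧
    ((σ ^ 2) • (1 : Matrix (Fin d) (Fin d) ℝ) - secondMoment z₀ ν).PosSemidef}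

/-- The Slater condition: `ρ > 0` and some probability measure on `Z` satisfies both constraints
strictly. -/
def SlaterCondition (p ε ρ σ : ℝ) (μ : Measure Z) (z₀ : EuclideanSpace ℝ (Fin d)) : Prop :=
  0 < ρ ∧ ∃ ν₀ : Measure Z, IsProbabilityMeasure ν₀ ∧
    robustWasserstein p ε μ ν₀ < ENNReal.ofReal ρ ∧ FiniteSecondMoment ν₀ ∧
    ((σ ^ 2) • (1 : Matrix (Fin d) (Fin d) ℝ) - secondMoment z₀ ν₀).PosDef

/-- The loss functions of the model: lower semicontinuous on `Z` with
`sup_{z ∈ Z} ℓ(z) / (1 + ‖z‖^p) < ∞`. -/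
def AdmissibleLoss (p : ℝ) (l : Z → ℝ) : Prop :=
  LowerSemicontinuous l ∧
    BddAbove (Set.range fun z : Z => l z / (1 + ‖(z : EuclideanSpace ℝ (Fin d))‖ ^ p))

/-- The bilinear form `xᵀ Λ y`. -/
def bil (Λ : Matrix (Fin d) (Fin d) ℝ) (x y : EuclideanSpace ℝ (Fin d)) : ℝ :=
  x.ofLp ⬝ᵥ (Λ *ᵥ y.ofLp)

/-- `sup_{ξ ∈ Z} [ℓ(ξ) - ξᵀΛξ + 2 ξᵀΛz₀ - λ ‖ξ - z‖^p - α]₊`, with values in `[0, ∞]`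
(`ENNReal.ofReal` is the positive part). -/
def lbar (p : ℝ) (l : Z → ℝ) (z₀ : EuclideanSpace ℝ (Fin d)) (Λ : Matrix (Fin d) (Fin d) ℝ)
    (lam α : ℝ) (z : Z) : ℝ≥0∞ :=
  ⨆ ξ : Z, ENNReal.ofReal (l ξ - bil Λ ξ ξ + 2 * bil Λ ξ z₀
    - lam * ‖(ξ : EuclideanSpace ℝ (Fin d)) - z‖ ^ p - α)

/-- The dual objective
`-z₀ᵀΛz₀ + σ² Tr Λ + λ ρ^p + α + (1 - ε)⁻¹ E_μ[lbar]`, with values in `(-∞, ∞]`. -/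
def dualObjective (p ε ρ σ : ℝ) (μ : Measure Z) (l : Z → ℝ) (z₀ : EuclideanSpace ℝ (Fin d))
    (Λ : Matrix (Fin d) (Fin d) ℝ) (lam α : ℝ) : EReal :=
  ((-bil Λ z₀ z₀ + σ ^ 2 * Λ.trace + lam * ρ ^ p + α : ℝ) : EReal) +
    ((ENNReal.ofReal (1 / (1 - ε)) * ∫⁻ z, lbar p l z₀ Λ lam α z ∂μ : ℝ≥0∞) : EReal)

end

end OutlierRobust

/-! Weak duality (`expect_le_dualObjective`): if `(x, y)` is drawn from a coupling of a trimmed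
measure `μ'` with `ν`, the definition of `lbar` gives pointwise `l y ≤ (y - z₀)ᵀΛ(y - z₀) - z₀ᵀΛz₀ +
λ‖x - y‖^p + α + lbar x`. Integrating, the covariance constraint bounds the first term by `σ² Tr Λ`,
the cost bound handles the third, and `lbar ≥ 0` with `μ' ≤ μ/(1-ε)` the last.

Strong duality (`exists_dualObjective_le`): triples (second moments, cost, expected loss) of trimmed
plans form a convex set. If the primal value is at most a real `B`, this set misses the open convex
set of triples that satisfy both constraints strictly and have loss above `B`. A separating
hyperplane supplies `Λ` and `λ` (`exists_matrix_multiplier`); the Slater point, truncated to have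
integrable loss (`exists_slater_plan`), keeps the hyperplane from being vertical.

Since `μ` is finitely supported, the Lagrangian bound need only be tested on plans sending mass `wᵢ`
from the `i`-th sample point to one point `ξᵢ`. Taking suprema over each `ξᵢ` leaves a finite linear
program in weights capped at `1/(n(1-ε))`, and `α` is its threshold (`exists_weights_eq_threshold`).
-/

/-! ### Finite-dimensional duality: capped weights and matrix multipliers -/

/-- The linear program `max ∑ wᵢ φᵢ` over weights `0 ≤ wᵢ ≤ t` of total mass one has a dual
solution without gap: some `α` satisfies `α + t ∑ (φᵢ - α)₊ = ∑ wᵢ φᵢ`. -/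
theorem exists_weights_eq_threshold {ι : Type*} [Fintype ι] (t : ℝ) (ht : 0 < t)
    (hcard : 1 ≤ t * Fintype.card ι) (φ : ι → ℝ) :
    ∃ (α : ℝ) (w : ι → ℝ), (∀ i, 0 ≤ w i) ∧ (∀ i, w i ≤ t) ∧ ∑ i, w i = 1 ∧
      α + t * ∑ i, max (φ i - α) 0 = ∑ i, w i * φ i := by
  classical
  have hne : (Finset.univ : Finset ι).Nonempty := by
    by_contra h
    rw [Finset.not_nonempty_iff_eq_empty] at h
    have : Fintype.card ι = 0 := by rw [← Finset.card_univ, h, Finset.card_empty]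
    rw [this] at hcard
    norm_num at hcard
  obtain ⟨i₀, -, hi₀⟩ := Finset.exists_min_image Finset.univ φ hne
  -- The threshold `α` is a quantile: the largest value of `φ` for which weight `t` on every index
  -- at or above it gives total mass at least one.
  have hSne : (Finset.univ.filter fun j => 1 ≤ t * (Finset.univ.filter fun i => φ j ≤ φ i).card
      : Finset ι).Nonempty := by
    refine ⟨i₀, Finset.mem_filter.2 ⟨Finset.mem_univ _, ?_⟩⟩
    rw [Finset.filter_true_of_mem hi₀]
    exact hcard
  obtain ⟨j₀, hj₀, hmax⟩ := Finset.exists_max_image _ φ hSne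
  set α := φ j₀ with hα
  have hK : 1 ≤ t * (Finset.univ.filter fun i => α ≤ φ i).card := (Finset.mem_filter.1 hj₀).2
  -- If the indices strictly above `α` carried more than mass one, the next larger value of `φ`
  -- would also qualify, against maximality.
  have hk : t * (Finset.univ.filter fun i => α < φ i).card ≤ 1 := by
    rcases (Finset.univ.filter fun i => α < φ i).eq_empty_or_nonempty with h | h
    · rw [h]; norm_num
    · obtain ⟨j₁, hj₁, hmin⟩ := Finset.exists_min_image _ φ h
      have h1 : α < φ j₁ := (Finset.mem_filter.1 hj₁).2
      have heq : (Finset.univ.filter fun i => α < φ i)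
          = Finset.univ.filter fun i => φ j₁ ≤ φ i := by
        ext i
        simp only [Finset.mem_filter, Finset.mem_univ, true_and]
        exact ⟨fun hi => hmin i (Finset.mem_filter.2 ⟨Finset.mem_univ _, hi⟩),
          fun hi => h1.trans_le hi⟩
      rw [heq]
      by_contra hcon
      push Not at hcon
      exact absurd (hmax j₁ (Finset.mem_filter.2 ⟨Finset.mem_univ _, hcon.le⟩)) (not_le.2 h1)
  have hsplit : ((Finset.univ.filter fun i => α ≤ φ i).card : ℝ)
      = (Finset.univ.filter fun i => α < φ i).card
        + (Finset.univ.filter fun i => φ i = α).card := by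
    rw [← Nat.cast_add, ← Finset.card_union_of_disjoint]
    · congr 2
      ext i
      simp only [Finset.mem_filter, Finset.mem_univ, true_and, Finset.mem_union,
        le_iff_lt_or_eq, eq_comm (a := α)]
    · rw [Finset.disjoint_filter]
      intro i _ h1 h2
      exact absurd h2 h1.ne'
  have he : (0 : ℝ) < (Finset.univ.filter fun i => φ i = α).card := by
    exact Nat.cast_pos.2 (Finset.card_pos.2 ⟨j₀, Finset.mem_filter.2 ⟨Finset.mem_univ _, rfl⟩⟩)
  set k : ℝ := ((Finset.univ.filter fun i => α < φ i).card : ℝ)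
  set e : ℝ := ((Finset.univ.filter fun i => φ i = α).card : ℝ)
  -- Indices above `α` get the full cap `t`; the remaining mass is split equally among the ties at
  -- `α`.
  set θ := (1 - t * k) / e with hθ
  have hθ0 : 0 ≤ θ := div_nonneg (by linarith) he.le
  have hθt : θ ≤ t := by
    rw [hθ, div_le_iff₀ he]
    rw [hsplit] at hK
    linarith
  set w : ι → ℝ := fun i => (if α < φ i then t else 0) + if φ i = α then θ else 0 with hw
  have hsum : ∑ i, w i = 1 := by
    simp only [hw, Finset.sum_add_distrib]
    rw [← Finset.sum_filter, ← Finset.sum_filter, Finset.sum_const, Finset.sum_const,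
      nsmul_eq_mul, nsmul_eq_mul]
    change k * t + e * θ = 1
    rw [hθ, mul_div_cancel₀ _ he.ne']
    ring
  refine ⟨α, w, fun i => ?_, fun i => ?_, hsum, ?_⟩
  · simp only [hw]
    split_ifs <;> linarith
  · simp only [hw]
    split_ifs <;> linarith
  · have h1 : ∑ i, w i * φ i = α + ∑ i, w i * (φ i - α) := by
      simp only [mul_sub, Finset.sum_sub_distrib]
      rw [← Finset.sum_mul, hsum]
      ring
    -- Complementary slackness: `wᵢ (φᵢ - α) = t (φᵢ - α)₊` holds term by term.
    rw [h1, Finset.mul_sum]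
    congr 1
    refine Finset.sum_congr rfl fun i _ => ?_
    simp only [hw]
    rcases lt_trichotomy (φ i) α with h | h | h
    · rw [if_neg h.not_gt, if_neg h.ne, max_eq_right (by linarith)]
      ring
    · simp [h]
    · rw [if_pos h, if_neg h.ne', max_eq_left (by linarith)]
      ring

/-- Gives the signs of the multipliers: a functional bounded above on a set cannot increase along a
ray contained in it. -/
theorem nonpos_of_forall_add_mul_lt {a b u : ℝ} (h : ∀ s : ℝ, 0 ≤ s → a + s * b < u) : b ≤ 0 := by
  by_contra hb
  push Not at hb
  have h1 := h (|u - a| / b) (by positivity)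
  rw [div_mul_cancel₀ _ hb.ne'] at h1
  linarith [le_abs_self (u - a)]

/-- The set of matrices whose quadratic form is strictly below `s ‖x‖²` is open. -/
theorem isOpen_setOf_quadratic_lt {d : ℕ} (s : ℝ) :
    IsOpen {N : Fin d → Fin d → ℝ |
      ∀ x : Fin d → ℝ, x ≠ 0 → x ⬝ᵥ (Matrix.of N *ᵥ x) < s * (x ⬝ᵥ x)} := by
  have hcont : Continuous fun q : (Fin d → Fin d → ℝ) × (Fin d → ℝ) =>
      s * (q.2 ⬝ᵥ q.2) - q.2 ⬝ᵥ (Matrix.of q.1 *ᵥ q.2) := by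
    simp only [dotProduct, Matrix.mulVec, Matrix.of_apply]
    fun_prop
  -- By homogeneity the condition need only hold on the unit sphere, whose compactness makes it open
  -- in `N`.
  have hset : {N : Fin d → Fin d → ℝ |
      ∀ x : Fin d → ℝ, x ≠ 0 → x ⬝ᵥ (Matrix.of N *ᵥ x) < s * (x ⬝ᵥ x)}
      = {N | ∀ x ∈ Metric.sphere (0 : Fin d → ℝ) 1,
          x ⬝ᵥ (Matrix.of N *ᵥ x) < s * (x ⬝ᵥ x)} := by
    ext N
    constructor
    · intro h x hx
      exact h x (Metric.ne_of_mem_sphere hx one_ne_zero)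
    · intro h x hx
      have hx' : 0 < ‖x‖ := norm_pos_iff.2 hx
      have h1 := h (‖x‖⁻¹ • x) (by
        rw [mem_sphere_zero_iff_norm, norm_smul, norm_inv, norm_norm, inv_mul_cancel₀ hx'.ne'])
      simp only [Matrix.mulVec_smul, dotProduct_smul, smul_dotProduct, smul_eq_mul] at h1
      have h2 : 0 < ‖x‖⁻¹ * ‖x‖⁻¹ := by positivity
      have h3 : ‖x‖⁻¹ * ‖x‖⁻¹ * (x ⬝ᵥ (Matrix.of N *ᵥ x))
          < ‖x‖⁻¹ * ‖x‖⁻¹ * (s * (x ⬝ᵥ x)) := by linarith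
      exact lt_of_mul_lt_mul_left h3 h2.le
  rw [hset, isOpen_iff_eventually]
  intro N hN
  refine (isCompact_sphere (0 : Fin d → ℝ) 1).eventually_forall_of_forall_eventually
    fun x hx => ?_
  have := hcont.continuousAt.eventually (lt_mem_nhds (sub_pos.2 (hN x hx)) :
    ∀ᶠ r in nhds (s * ((N, x).2 ⬝ᵥ (N, x).2) - (N, x).2 ⬝ᵥ (Matrix.of (N, x).1 *ᵥ (N, x).2)), 0 < r)
  filter_upwards [this] with q hq
  exact sub_pos.1 hq

/-- A continuous linear functional on `matrices × ℝ × ℝ` in coordinates. -/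
theorem dual_apply_eq_sum {d : ℕ} (f : StrongDual ℝ ((Fin d → Fin d → ℝ) × ℝ × ℝ))
    (N : Fin d → Fin d → ℝ) (t r : ℝ) :
    f (N, t, r) = ∑ i, ∑ j, N i j * f (Pi.single i (Pi.single j 1), 0, 0)
      + t * f (0, 1, 0) + r * f (0, 0, 1) := by
  have hN : (∑ i, ∑ j, N i j • (Pi.single i (Pi.single j 1) : Fin d → Fin d → ℝ)) = N := by
    ext a b
    simp only [Finset.sum_apply, Pi.smul_apply, smul_eq_mul]
    rw [Finset.sum_eq_single a, Finset.sum_eq_single b]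
    · simp
    · intro j _ hj
      simp [hj.symm]
    · simp
    · intro i _ hi
      refine Finset.sum_eq_zero fun j _ => ?_
      simp [hi.symm]
    · simp
  have h1 : f (N, 0, 0) = ∑ i, ∑ j, N i j * f (Pi.single i (Pi.single j 1), 0, 0) := by
    have h2 : ∀ M : Fin d → Fin d → ℝ,
        f (M, 0, 0) = (f.comp (ContinuousLinearMap.inl ℝ (Fin d → Fin d → ℝ) (ℝ × ℝ))) M :=
      fun _ => rfl
    rw [h2]
    conv_lhs => rw [← hN]
    simp only [map_sum, map_smul, smul_eq_mul, h2]
  have h3 : ((N, t, r) : (Fin d → Fin d → ℝ) × ℝ × ℝ)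
      = (N, 0, 0) + (t • (0, 1, 0) + r • (0, 0, 1)) := by
    ext <;> simp
  rw [h3, map_add, map_add, map_smul, map_smul, h1, smul_eq_mul, smul_eq_mul]
  ring

/-- Lagrange multipliers for a convex family of moments `(N, t, r)`: if `r ≤ B` whenever
`N ⪯ s I` and `t ≤ R`, and some member satisfies both constraints strictly, then the constraints
can be priced by a positive semidefinite matrix and a nonnegative number. -/
theorem exists_matrix_multiplier {d : ℕ} {A : Set ((Fin d → Fin d → ℝ) × ℝ × ℝ)}
    (hA : Convex ℝ A) {s R B : ℝ}
    (hB : ∀ a ∈ A, (∀ x : Fin d → ℝ, x ⬝ᵥ (Matrix.of a.1 *ᵥ x) ≤ s * (x ⬝ᵥ x)) →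
      a.2.1 ≤ R → a.2.2 ≤ B)
    (hslater : ∃ a ∈ A, (∀ x : Fin d → ℝ, x ≠ 0 → x ⬝ᵥ (Matrix.of a.1 *ᵥ x) < s * (x ⬝ᵥ x)) ∧
      a.2.1 < R) :
    ∃ Λ : Matrix (Fin d) (Fin d) ℝ, Λ.PosSemidef ∧ ∃ lam : ℝ, 0 ≤ lam ∧
      ∀ a ∈ A, (∀ i j, a.1 i j = a.1 j i) →
        a.2.2 + (s * Λ.trace - ∑ i, ∑ j, Λ i j * a.1 i j) + lam * (R - a.2.1) ≤ B := by
  set U : Set ((Fin d → Fin d → ℝ) × ℝ × ℝ) :=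
    {N | ∀ x : Fin d → ℝ, x ≠ 0 → x ⬝ᵥ (Matrix.of N *ᵥ x) < s * (x ⬝ᵥ x)} ×ˢ
      (Set.Iio R ×ˢ Set.Ioi B) with hU
  have hUo : IsOpen U := (isOpen_setOf_quadratic_lt s).prod (isOpen_Iio.prod isOpen_Ioi)
  have hquad : ∀ (a b : ℝ) (N M : Fin d → Fin d → ℝ) (x : Fin d → ℝ),
      x ⬝ᵥ (Matrix.of (a • N + b • M) *ᵥ x)
        = a * (x ⬝ᵥ (Matrix.of N *ᵥ x)) + b * (x ⬝ᵥ (Matrix.of M *ᵥ x)) := by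
    intro a b N M x
    have : (Matrix.of (a • N + b • M) : Matrix (Fin d) (Fin d) ℝ)
        = a • Matrix.of N + b • Matrix.of M := rfl
    rw [this, Matrix.add_mulVec, Matrix.smul_mulVec, Matrix.smul_mulVec, dotProduct_add,
      dotProduct_smul, dotProduct_smul, smul_eq_mul, smul_eq_mul]
  have hUc : Convex ℝ U := by
    refine Convex.prod ?_ ((convex_Iio R).prod (convex_Ioi B))
    intro N hN M hM a b ha hb hab x hx
    rw [hquad]
    have h1 := hN x hx
    have h2 := hM x hx
    rcases ha.eq_or_lt with rfl | ha'
    · have : b = 1 := by linarith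
      subst this
      linarith
    · have h3 := mul_lt_mul_of_pos_left h1 ha'
      have h4 := mul_le_mul_of_nonneg_left h2.le hb
      have h5 : a * (s * (x ⬝ᵥ x)) + b * (s * (x ⬝ᵥ x)) = s * (x ⬝ᵥ x) := by
        rw [← add_mul, hab, one_mul]
      linarith
  have hdisj : Disjoint U A := by
    rw [Set.disjoint_left]
    intro a haU haA
    refine absurd (hB a haA (fun x => ?_) (le_of_lt haU.2.1)) (not_le.2 haU.2.2)
    rcases eq_or_ne x 0 with rfl | hx
    · simp
    · exact (haU.1 x hx).le
  obtain ⟨f, u, hfU, hfA⟩ := geometric_hahn_banach_open hUc hUo hA hdisj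
  obtain ⟨⟨N₀, t₀, r₀⟩, ha₀, hN₀, ht₀⟩ := hslater
  simp only at hN₀ ht₀
  set Γ : Fin d → Fin d → ℝ := fun i j => f (Pi.single i (Pi.single j 1), 0, 0) with hΓ
  set β := f (0, 1, 0) with hβ
  set κ := f (0, 0, 1) with hκ
  have hf : ∀ N t r, f (N, t, r) = ∑ i, ∑ j, N i j * Γ i j + t * β + r * κ :=
    dual_apply_eq_sum f
  have hmem : ∀ N t r, (∀ x : Fin d → ℝ, x ≠ 0 → x ⬝ᵥ (Matrix.of N *ᵥ x) < s * (x ⬝ᵥ x)) →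
      t < R → B < r → f (N, t, r) < u := fun N t r h1 h2 h3 => hfU _ ⟨h1, h2, h3⟩
  have hu₀ : f (N₀, t₀, B + 1) < u := hmem _ _ _ hN₀ ht₀ (by linarith)
  have hβ0 : 0 ≤ β := by
    have : -β ≤ 0 := nonpos_of_forall_add_mul_lt (a := f (N₀, t₀, B + 1)) (u := u) fun s hs => by
      have := hmem N₀ (t₀ - s) (B + 1) hN₀ (by linarith) (by linarith)
      rw [hf] at this ⊢
      linarith
    linarith
  have hκ0 : κ ≤ 0 := nonpos_of_forall_add_mul_lt (a := f (N₀, t₀, B + 1)) (u := u) fun s hs => by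
    have := hmem N₀ t₀ (B + 1 + s) hN₀ ht₀ (by linarith)
    rw [hf] at this ⊢
    linarith
  -- A vertical hyperplane is impossible: with `κ = 0` the functional takes the same value at the
  -- Slater point in `A` and at the point of `U` above it.
  have hκneg : κ < 0 := by
    rcases hκ0.lt_or_eq with h | h
    · exact h
    · have h1 := hfA _ ha₀
      rw [hf] at h1 hu₀
      rw [h] at h1 hu₀
      linarith
  -- Subtracting `s y yᵀ` from `N₀` preserves the strict matrix bound for every `s ≥ 0`, so `Γ` is
  -- nonnegative on rank-one matrices `y yᵀ`.
  have hΓ0 : ∀ y : Fin d → ℝ, 0 ≤ ∑ i, ∑ j, y i * y j * Γ i j := by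
    intro y
    have : -∑ i, ∑ j, y i * y j * Γ i j ≤ 0 :=
      nonpos_of_forall_add_mul_lt (a := f (N₀, t₀, B + 1)) (u := u) fun s hs => by
        have h1 := hmem ((1 : ℝ) • N₀ + (-s) • fun i j => y i * y j) t₀ (B + 1) (fun x hx => by
          rw [hquad]
          have h2 : x ⬝ᵥ (Matrix.of (fun i j => y i * y j) *ᵥ x) = (x ⬝ᵥ y) * (x ⬝ᵥ y) := by
            have : Matrix.of (fun i j => y i * y j) *ᵥ x = (y ⬝ᵥ x) • y := by
              ext i
              simp only [Matrix.mulVec, dotProduct, Matrix.of_apply, Pi.smul_apply, smul_eq_mul,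
                Finset.sum_mul]
              exact Finset.sum_congr rfl fun j _ => by ring
            rw [this, dotProduct_smul, smul_eq_mul, dotProduct_comm y x]
          rw [h2]
          nlinarith [hN₀ x hx, mul_nonneg hs (mul_self_nonneg (x ⬝ᵥ y))]) ht₀ (by linarith)
        rw [hf] at h1 ⊢
        have h3 : ∑ i, ∑ j, ((1 : ℝ) • N₀ + (-s) • fun i j => y i * y j) i j * Γ i j
            = ∑ i, ∑ j, N₀ i j * Γ i j + s * -∑ i, ∑ j, y i * y j * Γ i j := by
          rw [mul_neg, Finset.mul_sum, ← sub_eq_add_neg, ← Finset.sum_sub_distrib]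
          refine Finset.sum_congr rfl fun i _ => ?_
          rw [Finset.mul_sum, ← Finset.sum_sub_distrib]
          refine Finset.sum_congr rfl fun j _ => ?_
          simp only [Pi.add_apply, Pi.smul_apply, smul_eq_mul]
          ring
        rw [h3] at h1
        linarith
    linarith
  set M₁ : Fin d → Fin d → ℝ := fun i j => if i = j then s else 0 with hM₁
  have hM₁q : ∀ x : Fin d → ℝ, x ⬝ᵥ (Matrix.of M₁ *ᵥ x) = s * (x ⬝ᵥ x) := by
    intro x
    have : Matrix.of M₁ = s • (1 : Matrix (Fin d) (Fin d) ℝ) := by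
      ext i j
      simp [hM₁, Matrix.one_apply]
    rw [this, Matrix.smul_mulVec, Matrix.one_mulVec, dotProduct_smul, smul_eq_mul]
  -- The corner `(s I, R, B)` lies in the closure of `U`: it is approached along the segment from
  -- `(N₀, t₀, B + 1)`.
  have hcorner : f (M₁, R, B) ≤ u := by
    refine le_of_forall_pos_lt_add fun η hη => ?_
    set D := f (N₀, t₀, B + 1) - f (M₁, R, B) with hD
    obtain ⟨δ, hδ0, hδ1, hδ⟩ : ∃ δ : ℝ, 0 < δ ∧ δ ≤ 1 ∧ δ * |D| < η := by
      refine ⟨min 1 (η / (2 * (|D| + 1))), by positivity, min_le_left _ _, ?_⟩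
      have h1 : min 1 (η / (2 * (|D| + 1))) * |D| ≤ η / (2 * (|D| + 1)) * (|D| + 1) := by
        gcongr
        · exact min_le_right _ _
        · linarith
      have h2 : η / (2 * (|D| + 1)) * (|D| + 1) = η / 2 := by
        field_simp
      linarith
    have h1 := hmem ((1 - δ) • M₁ + δ • N₀) ((1 - δ) * R + δ * t₀) ((1 - δ) * B + δ * (B + 1))
      (fun x hx => by
        rw [hquad, hM₁q]
        nlinarith [hN₀ x hx]) (by nlinarith) (by nlinarith)
    have h2 : (((1 - δ) • M₁ + δ • N₀, (1 - δ) * R + δ * t₀, (1 - δ) * B + δ * (B + 1)) :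
        (Fin d → Fin d → ℝ) × ℝ × ℝ) = (1 - δ) • (M₁, R, B) + δ • (N₀, t₀, B + 1) := rfl
    rw [h2, map_add, map_smul, map_smul, smul_eq_mul, smul_eq_mul] at h1
    have h3 := neg_abs_le D
    nlinarith
  have hτ : 0 < -κ := by linarith
  -- Dividing by `-κ` normalizes the price of the loss to one. `Γ` acts on all matrices and need not
  -- be symmetric; its symmetrization agrees with it on symmetric `N`.
  refine ⟨Matrix.of fun i j => (Γ i j + Γ j i) / (2 * -κ), ?_, β / -κ, by positivity, ?_⟩
  · rw [Matrix.posSemidef_iff_dotProduct_mulVec]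
    constructor
    · ext i j
      simp [Matrix.conjTranspose_apply, add_comm]
    · intro y
      have h1 : star y ⬝ᵥ ((Matrix.of fun i j => (Γ i j + Γ j i) / (2 * -κ)) *ᵥ y)
          = (∑ i, ∑ j, y i * y j * Γ i j) / -κ := by
        have h2 : ∑ i, ∑ j, y i * y j * Γ j i = ∑ i, ∑ j, y i * y j * Γ i j := by
          rw [Finset.sum_comm]
          exact Finset.sum_congr rfl fun i _ => Finset.sum_congr rfl fun j _ => by ring
        have h3 : star y ⬝ᵥ ((Matrix.of fun i j => (Γ i j + Γ j i) / (2 * -κ)) *ᵥ y)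
            = (∑ i, ∑ j, y i * y j * Γ i j + ∑ i, ∑ j, y i * y j * Γ j i) / (2 * -κ) := by
          simp only [dotProduct, Matrix.mulVec, Matrix.of_apply, star_trivial,
            ← Finset.sum_add_distrib, Finset.sum_div, Finset.mul_sum]
          exact Finset.sum_congr rfl fun i _ => Finset.sum_congr rfl fun j _ => by ring
        rw [h3, h2]
        field_simp
        ring
      rw [h1]
      exact div_nonneg (hΓ0 y) hτ.le
  · rintro ⟨N, t, r⟩ ha hsymm
    simp only at hsymm ⊢
    have h1 := hcorner.trans (hfA _ ha)
    rw [hf, hf] at h1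
    have h2 : ∑ i, ∑ j, M₁ i j * Γ i j = s * ∑ i, Γ i i := by
      simp [hM₁, ite_mul, Finset.mul_sum]
    have h3 : (Matrix.of fun i j => (Γ i j + Γ j i) / (2 * -κ)).trace = (∑ i, Γ i i) / -κ := by
      simp only [Matrix.trace, Matrix.diag_apply, Matrix.of_apply, Finset.sum_div]
      refine Finset.sum_congr rfl fun i _ => ?_
      field_simp
      ring
    have h4 : ∑ i, ∑ j, (Matrix.of fun i j => (Γ i j + Γ j i) / (2 * -κ)) i j * N i j
        = (∑ i, ∑ j, N i j * Γ i j) / -κ := by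
      have h5 : ∑ i, ∑ j, N i j * Γ j i = ∑ i, ∑ j, N i j * Γ i j := by
        rw [Finset.sum_comm]
        exact Finset.sum_congr rfl fun i _ => Finset.sum_congr rfl fun j _ => by rw [hsymm]
      have h6 : ∑ i, ∑ j, (Matrix.of fun i j => (Γ i j + Γ j i) / (2 * -κ)) i j * N i j
          = (∑ i, ∑ j, N i j * Γ i j + ∑ i, ∑ j, N i j * Γ j i) / (2 * -κ) := by
        simp only [Matrix.of_apply, ← Finset.sum_add_distrib, Finset.sum_div]
        exact Finset.sum_congr rfl fun i _ => Finset.sum_congr rfl fun j _ => by ring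
      rw [h6, h5]
      field_simp
      ring
    rw [h2] at h1
    rw [h3, h4]
    refine le_of_mul_le_mul_right ?_ hτ
    have h7 : (r + (s * ((∑ i, Γ i i) / -κ) - (∑ i, ∑ j, N i j * Γ i j) / -κ)
        + β / -κ * (R - t)) * -κ
        = r * -κ + (s * (∑ i, Γ i i) - (∑ i, ∑ j, N i j * Γ i j)) + β * (R - t) := by
      have := hκneg.ne
      field_simp
      ring
    rw [h7]
    linarith

open scoped MatrixOrder in
-- `Tr (A B) = Tr (√A B √A)`, the trace of a positive semidefinite matrix.
theorem Matrix.PosSemidef.trace_mul_nonneg_real {d : ℕ} {A B : Matrix (Fin d) (Fin d) ℝ}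
    (hA : A.PosSemidef) (hB : B.PosSemidef) : 0 ≤ (A * B).trace := by
  have h0 : CFC.sqrt A * CFC.sqrt A = A := CFC.sqrt_mul_sqrt_self A hA.nonneg
  have h1 : (CFC.sqrt A)ᴴ = CFC.sqrt A :=
    (Matrix.nonneg_iff_posSemidef.1 (CFC.sqrt_nonneg A)).isHermitian
  have h2 := (hB.mul_mul_conjTranspose_same (CFC.sqrt A)).trace_nonneg
  rw [h1, Matrix.trace_mul_comm, ← mul_assoc, h0] at h2
  exact h2

namespace OutlierRobust

/-! ### Extended-valued expectation -/

section expectation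

variable {Ω Ω' : Type*} [MeasurableSpace Ω] [MeasurableSpace Ω']

theorem expect_eq_integral {ν : Measure Ω} {f : Ω → ℝ} (hf : Integrable f ν) :
    expect ν f = ((∫ z, f z ∂ν : ℝ) : EReal) := by
  have h1 : ∫⁻ z, ENNReal.ofReal (f z) ∂ν ≠ ∞ := hf.lintegral_lt_top.ne
  have h2 : ∫⁻ z, ENNReal.ofReal (-f z) ∂ν ≠ ∞ := hf.neg.lintegral_lt_top.ne
  rw [expect, integral_eq_lintegral_pos_part_sub_lintegral_neg_part hf, EReal.coe_sub,
    EReal.coe_ennreal_toReal h1, EReal.coe_ennreal_toReal h2]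

/-- The integrable majorant controls only the positive part of `f`; if the negative part has
infinite integral, the expectation is `⊥` and the bound is trivial. -/
theorem expect_map_le {π : Measure Ω} {g : Ω → Ω'} (hg : Measurable g) {f : Ω' → ℝ}
    (hf : Measurable f) {u : Ω → ℝ} (hu : Integrable u π) (hle : ∀ᵐ w ∂π, f (g w) ≤ u w) :
    expect (π.map g) f ≤ ((∫ w, u w ∂π : ℝ) : EReal) := by
  have hpos : ∫⁻ z, ENNReal.ofReal (f z) ∂(π.map g) ≠ ∞ := by
    rw [lintegral_map hf.ennreal_ofReal hg]
    refine ne_of_lt (lt_of_le_of_lt (lintegral_mono_ae ?_) hu.lintegral_lt_top)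
    filter_upwards [hle] with w hw using ENNReal.ofReal_le_ofReal hw
  by_cases hneg : ∫⁻ z, ENNReal.ofReal (-f z) ∂(π.map g) = ∞
  · rw [expect, hneg, EReal.coe_ennreal_top, EReal.sub_top]
    exact bot_le
  · have hint : Integrable f (π.map g) := by
      refine ⟨hf.aestronglyMeasurable, ?_⟩
      have h1 : ∀ z, ‖f z‖ₑ = ENNReal.ofReal (f z) + ENNReal.ofReal (-f z) := by
        intro z
        rw [Real.enorm_eq_ofReal_abs]
        rcases le_total 0 (f z) with h | h
        · rw [abs_of_nonneg h, ENNReal.ofReal_of_nonpos (by linarith : -f z ≤ 0), add_zero]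
        · rw [abs_of_nonpos h, ENNReal.ofReal_of_nonpos h, zero_add]
      rw [HasFiniteIntegral]
      simp only [h1]
      rw [lintegral_add_left hf.ennreal_ofReal]
      exact ENNReal.add_lt_top.2 ⟨hpos.lt_top, lt_top_iff_ne_top.2 hneg⟩
    rw [expect_eq_integral hint, integral_map hg.aemeasurable hf.aestronglyMeasurable]
    exact EReal.coe_le_coe_iff.2 (integral_mono_ae (hint.comp_measurable hg) hu hle)

end expectation

variable {d : ℕ} {Z : Set (EuclideanSpace ℝ (Fin d))}

/-! ### Couplings, second moments and weak duality -/

theorem bil_eq_sum (Λ : Matrix (Fin d) (Fin d) ℝ) (x y : EuclideanSpace ℝ (Fin d)) :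
    bil Λ x y = ∑ i, ∑ j, Λ i j * (x i * y j) := by
  simp only [bil, dotProduct, Matrix.mulVec, Finset.mul_sum]
  exact Finset.sum_congr rfl fun i _ => Finset.sum_congr rfl fun j _ => by ring

theorem bil_sub_self {Λ : Matrix (Fin d) (Fin d) ℝ} (hΛ : Λ.PosSemidef)
    (x y : EuclideanSpace ℝ (Fin d)) :
    bil Λ (x - y) (x - y) = bil Λ x x - 2 * bil Λ x y + bil Λ y y := by
  have hs : bil Λ y x = bil Λ x y := by
    rw [bil_eq_sum, bil_eq_sum, Finset.sum_comm]
    refine Finset.sum_congr rfl fun i _ => Finset.sum_congr rfl fun j _ => ?_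
    have : Λ j i = Λ i j := by simpa using hΛ.isHermitian.apply i j
    rw [this]
    ring
  have h1 : bil Λ (x - y) (x - y) = bil Λ x x - bil Λ x y - bil Λ y x + bil Λ y y := by
    simp only [bil_eq_sum, PiLp.sub_apply, ← Finset.sum_sub_distrib, ← Finset.sum_add_distrib]
    exact Finset.sum_congr rfl fun i _ => Finset.sum_congr rfl fun j _ => by ring
  rw [h1, hs]
  ring

/-- A supremum of functions continuous in `z` is lower semicontinuous, however many `ξ` there are
and whatever `l` is. -/
theorem lbar_measurable (p : ℝ) (hp : 0 ≤ p) (l : Z → ℝ) (z₀ : EuclideanSpace ℝ (Fin d))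
    (Λ : Matrix (Fin d) (Fin d) ℝ) (lam α : ℝ) : Measurable (lbar p l z₀ Λ lam α) := by
  refine LowerSemicontinuous.measurable (lowerSemicontinuous_iSup fun ξ => ?_)
  refine Continuous.lowerSemicontinuous (ENNReal.continuous_ofReal.comp ?_)
  have : Continuous fun z : Z => ‖(ξ : EuclideanSpace ℝ (Fin d)) - z‖ ^ p :=
    (continuous_const.sub continuous_subtype_val).norm.rpow_const fun _ => Or.inr hp
  fun_prop

theorem measurable_cost (p : ℝ) :
    Measurable fun w : Z × Z => ‖(w.1 : EuclideanSpace ℝ (Fin d)) - w.2‖ ^ p :=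
  (((measurable_subtype_coe.comp measurable_fst).sub
    (measurable_subtype_coe.comp measurable_snd)).norm).pow_const p

/-- A robust Wasserstein bound yields a coupling whose first marginal is a trimmed version of `μ`
and whose transport cost obeys the bound. -/
theorem exists_coupling_of_robustWasserstein_lt {p ε r : ℝ} (hp : 1 ≤ p) (hr : 0 ≤ r)
    {μ ν : Measure Z} (h : robustWasserstein p ε μ ν < ENNReal.ofReal r) :
    ∃ π : Measure (Z × Z), IsProbabilityMeasure π ∧
      π.map Prod.fst ≤ ENNReal.ofReal (1 / (1 - ε)) • μ ∧ π.map Prod.snd = ν ∧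
      ∫⁻ w, ENNReal.ofReal (‖(w.1 : EuclideanSpace ℝ (Fin d)) - w.2‖ ^ p) ∂π
        < ENNReal.ofReal (r ^ p) := by
  have hp0 : 0 < p := by linarith
  simp only [robustWasserstein, wasserstein, iInf_lt_iff] at h
  obtain ⟨μ', ⟨hμ', hle⟩, π, ⟨hπ1, hπ2⟩, hlt⟩ := h
  have hπ : IsProbabilityMeasure π := by
    constructor
    have := hμ'.measure_univ
    rw [← hπ1, Measure.map_apply measurable_fst MeasurableSet.univ] at this
    simpa using this
  refine ⟨π, hπ, hπ1 ▸ hle, hπ2, ?_⟩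
  have h1 := ENNReal.rpow_lt_rpow hlt hp0
  rwa [← ENNReal.rpow_mul, one_div_mul_cancel hp0.ne', ENNReal.rpow_one,
    ENNReal.ofReal_rpow_of_nonneg hr hp0.le] at h1

theorem robustWasserstein_le_of_coupling {p ε r : ℝ} (hp : 1 ≤ p) (hr : 0 ≤ r)
    {μ : Measure Z} (π : Measure (Z × Z)) [IsProbabilityMeasure π]
    (hπ : π.map Prod.fst ≤ ENNReal.ofReal (1 / (1 - ε)) • μ)
    (hc : ∫⁻ w, ENNReal.ofReal (‖(w.1 : EuclideanSpace ℝ (Fin d)) - w.2‖ ^ p) ∂π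
        ≤ ENNReal.ofReal (r ^ p)) :
    robustWasserstein p ε μ (π.map Prod.snd) ≤ ENNReal.ofReal r := by
  have hp0 : 0 < p := by linarith
  refine iInf₂_le_of_le (π.map Prod.fst)
    ⟨Measure.isProbabilityMeasure_map measurable_fst.aemeasurable, hπ⟩ ?_
  refine iInf₂_le_of_le π ⟨rfl, rfl⟩ ?_
  refine (ENNReal.rpow_le_rpow hc (by positivity)).trans_eq ?_
  rw [← ENNReal.ofReal_rpow_of_nonneg hr hp0.le, ← ENNReal.rpow_mul, mul_one_div_cancel hp0.ne',
    ENNReal.rpow_one]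

theorem FiniteSecondMoment.integrable_mul {ν : Measure Z} [IsFiniteMeasure ν]
    (h : FiniteSecondMoment ν) (z₀ : EuclideanSpace ℝ (Fin d)) (i j : Fin d) :
    Integrable (fun z : Z => ((z : EuclideanSpace ℝ (Fin d)) i - z₀ i) *
      ((z : EuclideanSpace ℝ (Fin d)) j - z₀ j)) ν := by
  have h1 : ∀ k : Fin d, MemLp (fun z : Z => (z : EuclideanSpace ℝ (Fin d)) k - z₀ k) 2 ν := by
    intro k
    refine MemLp.sub (MemLp.of_le h ?_ (Filter.Eventually.of_forall fun z => ?_)) (memLp_const _)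
    · exact (((EuclideanSpace.proj (𝕜 := ℝ) k).continuous.measurable).comp
        measurable_subtype_coe).aestronglyMeasurable
    · exact PiLp.norm_apply_le _ k
  exact (h1 i).integrable_mul (h1 j)

theorem integrable_bil_sub {ν : Measure Z} [IsFiniteMeasure ν] (h : FiniteSecondMoment ν)
    (z₀ : EuclideanSpace ℝ (Fin d)) (Λ : Matrix (Fin d) (Fin d) ℝ) :
    Integrable (fun z : Z => bil Λ (z - z₀) (z - z₀)) ν := by
  simp only [bil_eq_sum, PiLp.sub_apply]
  exact integrable_finsetSum _ fun i _ => integrable_finsetSum _ fun j _ =>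
    (h.integrable_mul z₀ i j).const_mul _

theorem integral_bil_sub {ν : Measure Z} [IsFiniteMeasure ν] (h : FiniteSecondMoment ν)
    (z₀ : EuclideanSpace ℝ (Fin d)) (Λ : Matrix (Fin d) (Fin d) ℝ) :
    ∫ z : Z, bil Λ (z - z₀) (z - z₀) ∂ν = ∑ i, ∑ j, Λ i j * secondMoment z₀ ν i j := by
  have h1 : ∀ i j, Integrable (fun z : Z => Λ i j * (((z : EuclideanSpace ℝ (Fin d)) i - z₀ i) *
      ((z : EuclideanSpace ℝ (Fin d)) j - z₀ j))) ν := fun i j =>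
    (h.integrable_mul z₀ i j).const_mul _
  simp only [bil_eq_sum, PiLp.sub_apply, secondMoment, Matrix.of_apply]
  refine (integral_finsetSum _ fun i _ => integrable_finsetSum _ fun j _ => h1 i j).trans ?_
  refine Finset.sum_congr rfl fun i _ => ?_
  refine (integral_finsetSum _ fun j _ => h1 i j).trans ?_
  exact Finset.sum_congr rfl fun j _ => integral_const_mul _ _

theorem secondMoment_comm (z₀ : EuclideanSpace ℝ (Fin d)) (ν : Measure Z) (i j : Fin d) :
    secondMoment z₀ ν i j = secondMoment z₀ ν j i := by
  simp only [secondMoment, Matrix.of_apply, mul_comm]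

theorem integral_bil_sub_le {ν : Measure Z} {σ : ℝ} {z₀ : EuclideanSpace ℝ (Fin d)}
    (h : ν ∈ Gcov Z σ z₀) {Λ : Matrix (Fin d) (Fin d) ℝ} (hΛ : Λ.PosSemidef) :
    ∫ z : Z, bil Λ (z - z₀) (z - z₀) ∂ν ≤ σ ^ 2 * Λ.trace := by
  obtain ⟨hν, h2, hM⟩ := h
  rw [integral_bil_sub h2]
  have h3 := hΛ.trace_mul_nonneg_real hM
  have h4 : (Λ * secondMoment z₀ ν).trace = ∑ i, ∑ j, Λ i j * secondMoment z₀ ν i j := by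
    simp only [Matrix.trace, Matrix.diag_apply, Matrix.mul_apply]
    exact Finset.sum_congr rfl fun i _ => Finset.sum_congr rfl fun j _ => by
      rw [secondMoment_comm]
  rw [mul_sub, Matrix.trace_sub, h4, mul_smul_comm, mul_one, Matrix.trace_smul, smul_eq_mul] at h3
  linarith

/-- Weak duality. -/
theorem expect_le_dualObjective {p ε ρ σ : ℝ} (hp : 1 ≤ p) (hε₁ : ε < 1) (hρ : 0 < ρ)
    {μ ν : Measure Z} {z₀ : EuclideanSpace ℝ (Fin d)} {l : Z → ℝ} (hl : Measurable l)
    (hν : ν ∈ Gcov Z σ z₀) (hW : robustWasserstein p ε μ ν ≤ ENNReal.ofReal ρ)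
    {Λ : Matrix (Fin d) (Fin d) ℝ} (hΛ : Λ.PosSemidef) {lam : ℝ} (hlam : 0 ≤ lam) (α : ℝ) :
    expect ν l ≤ dualObjective p ε ρ σ μ l z₀ Λ lam α := by
  have hp0 : 0 < p := by linarith
  have hν1 := hν.1
  have hc : (0 : ℝ) < 1 / (1 - ε) := one_div_pos.2 (by linarith)
  set T := ∫⁻ z, lbar p l z₀ Λ lam α z ∂μ with hT
  rcases eq_or_ne T ∞ with hTtop | hTfin
  · rw [dualObjective, ← hT, hTtop, ENNReal.mul_top (ENNReal.ofReal_pos.2 hc).ne',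
      EReal.coe_ennreal_top, EReal.coe_add_top]
    exact le_top
  have hcT : ENNReal.ofReal (1 / (1 - ε)) * T ≠ ∞ := ENNReal.mul_ne_top ENNReal.ofReal_ne_top hTfin
  -- The infima in the robust distance need not be attained, so a coupling is taken with cost below
  -- `r ^ p` for each `r > ρ`; then `r` decreases to `ρ`.
  have key : ∀ r : ℝ, ρ < r → expect ν l ≤ ((-bil Λ z₀ z₀ + σ ^ 2 * Λ.trace + lam * r ^ p + α
      + (ENNReal.ofReal (1 / (1 - ε)) * T).toReal : ℝ) : EReal) := by
    intro r hr
    have hr0 : 0 < r := hρ.trans hr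
    obtain ⟨π, hπ, hfst, hsnd, hcost⟩ := exists_coupling_of_robustWasserstein_lt hp hr0.le
      (hW.trans_lt ((ENNReal.ofReal_lt_ofReal_iff hr0).2 hr))
    have hlm := lbar_measurable p hp0.le l z₀ Λ lam α
    have hlbar : ∫⁻ w, lbar p l z₀ Λ lam α w.1 ∂π ≤ ENNReal.ofReal (1 / (1 - ε)) * T := by
      rw [← lintegral_map hlm measurable_fst, hT, ← smul_eq_mul, ← lintegral_smul_measure]
      exact lintegral_mono' hfst le_rfl
    have hlbar' := ne_top_of_le_ne_top hcT hlbar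
    have hi1 : Integrable (fun w : Z × Z => (lbar p l z₀ Λ lam α w.1).toReal) π :=
      integrable_toReal_of_lintegral_ne_top (hlm.comp measurable_fst).aemeasurable hlbar'
    have hi2 : Integrable (fun w : Z × Z => ‖(w.1 : EuclideanSpace ℝ (Fin d)) - w.2‖ ^ p) π := by
      refine ⟨(measurable_cost p).aestronglyMeasurable, ?_⟩
      rw [hasFiniteIntegral_iff_ofReal (Filter.Eventually.of_forall fun w => by positivity)]
      exact hcost.trans ENNReal.ofReal_lt_top
    have hi3' : Integrable (fun z : Z => bil Λ (z - z₀) (z - z₀)) (π.map Prod.snd) :=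
      hsnd ▸ integrable_bil_sub hν.2.1 z₀ Λ
    have hi3 : Integrable (fun w : Z × Z => bil Λ (w.2 - z₀) (w.2 - z₀)) π :=
      hi3'.comp_measurable measurable_snd
    have hv1 : ∫ w : Z × Z, (lbar p l z₀ Λ lam α w.1).toReal ∂π
        ≤ (ENNReal.ofReal (1 / (1 - ε)) * T).toReal := by
      rw [integral_toReal (f := fun w : Z × Z => lbar p l z₀ Λ lam α w.1)
        (hlm.comp measurable_fst).aemeasurable (ae_lt_top (hlm.comp measurable_fst) hlbar')]
      exact ENNReal.toReal_mono hcT hlbar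
    have hv2 : ∫ w : Z × Z, ‖(w.1 : EuclideanSpace ℝ (Fin d)) - w.2‖ ^ p ∂π ≤ r ^ p := by
      rw [← ENNReal.ofReal_le_ofReal_iff (by positivity), ofReal_integral_eq_lintegral_ofReal hi2
        (Filter.Eventually.of_forall fun w => by positivity)]
      exact hcost.le
    have hv3 : ∫ w : Z × Z, bil Λ (w.2 - z₀) (w.2 - z₀) ∂π ≤ σ ^ 2 * Λ.trace := by
      have := integral_bil_sub_le hν hΛ
      rwa [← hsnd, integral_map measurable_snd.aemeasurable hi3'.aestronglyMeasurable] at this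
    have hi4 : Integrable (fun w : Z × Z => bil Λ (w.2 - z₀) (w.2 - z₀)
        + lam * ‖(w.1 : EuclideanSpace ℝ (Fin d)) - w.2‖ ^ p) π := hi3.add (hi2.const_mul lam)
    have hi5 : Integrable (fun w : Z × Z => bil Λ (w.2 - z₀) (w.2 - z₀)
        + lam * ‖(w.1 : EuclideanSpace ℝ (Fin d)) - w.2‖ ^ p
        + (lbar p l z₀ Λ lam α w.1).toReal) π := hi4.add hi1
    have hu : Integrable (fun w : Z × Z => bil Λ (w.2 - z₀) (w.2 - z₀)
        + lam * ‖(w.1 : EuclideanSpace ℝ (Fin d)) - w.2‖ ^ p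
        + (lbar p l z₀ Λ lam α w.1).toReal + (α - bil Λ z₀ z₀)) π :=
      hi5.add (integrable_const _)
    have hle := expect_map_le measurable_snd hl hu (by
      filter_upwards [ae_lt_top (hlm.comp measurable_fst) hlbar'] with w hw
      have h1 : ENNReal.ofReal (l w.2 - bil Λ w.2 w.2 + 2 * bil Λ w.2 z₀
          - lam * ‖(w.2 : EuclideanSpace ℝ (Fin d)) - w.1‖ ^ p - α) ≤ lbar p l z₀ Λ lam α w.1 :=
        le_iSup (fun ξ : Z => ENNReal.ofReal (l ξ - bil Λ ξ ξ + 2 * bil Λ ξ z₀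
          - lam * ‖(ξ : EuclideanSpace ℝ (Fin d)) - w.1‖ ^ p - α)) w.2
      have h2 := (ENNReal.ofReal_le_iff_le_toReal hw.ne).1 h1
      rw [bil_sub_self hΛ, norm_sub_rev (w.1 : EuclideanSpace ℝ (Fin d))]
      simp only [Function.comp] at h2
      linarith)
    rw [hsnd] at hle
    refine hle.trans (EReal.coe_le_coe_iff.2 ?_)
    rw [integral_add hi5 (integrable_const _), integral_add hi4 hi1, integral_add hi3 (hi2.const_mul lam),
      integral_const_mul, integral_const, probReal_univ, one_smul]
    have := mul_le_mul_of_nonneg_left hv2 hlam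
    linarith
  have hdual : dualObjective p ε ρ σ μ l z₀ Λ lam α = ((-bil Λ z₀ z₀ + σ ^ 2 * Λ.trace
      + lam * ρ ^ p + α + (ENNReal.ofReal (1 / (1 - ε)) * T).toReal : ℝ) : EReal) := by
    rw [dualObjective, ← hT, EReal.coe_add _ (ENNReal.toReal _), EReal.coe_ennreal_toReal hcT]
  rw [hdual]
  have htend : Filter.Tendsto (fun r : ℝ => ((-bil Λ z₀ z₀ + σ ^ 2 * Λ.trace + lam * r ^ p + α
      + (ENNReal.ofReal (1 / (1 - ε)) * T).toReal : ℝ) : EReal)) (nhdsWithin ρ (Set.Ioi ρ))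
      (nhds ((-bil Λ z₀ z₀ + σ ^ 2 * Λ.trace + lam * ρ ^ p + α
      + (ENNReal.ofReal (1 / (1 - ε)) * T).toReal : ℝ) : EReal)) := by
    refine Filter.Tendsto.mono_left (Continuous.tendsto ?_ ρ) nhdsWithin_le_nhds
    have : Continuous fun r : ℝ => r ^ p := Real.continuous_rpow_const hp0.le
    exact continuous_coe_real_ereal.comp (by fun_prop)
  exact ge_of_tendsto htend (by filter_upwards [self_mem_nhdsWithin] with r hr using key r hr)

end OutlierRobust

/-! ### Trimmed plans, their moments and strong duality -/

theorem MeasureTheory.integral_sum_smul_dirac {Ω ι : Type*} [MeasurableSpace Ω]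
    [MeasurableSingletonClass Ω] [Fintype ι] {w : ι → ℝ} (hw : ∀ i, 0 ≤ w i) (x : ι → Ω)
    (f : Ω → ℝ) :
    Integrable f (∑ i, ENNReal.ofReal (w i) • Measure.dirac (x i)) ∧
      ∫ y, f y ∂(∑ i, ENNReal.ofReal (w i) • Measure.dirac (x i)) = ∑ i, w i * f (x i) := by
  have h : ∀ i ∈ Finset.univ, Integrable f (ENNReal.ofReal (w i) • Measure.dirac (x i)) :=
    fun i _ => (integrable_dirac (by simp)).smul_measure ENNReal.ofReal_ne_top
  refine ⟨integrable_finsetSum_measure.2 h, ?_⟩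
  rw [integral_finsetSum_measure h]
  refine Finset.sum_congr rfl fun i _ => ?_
  rw [integral_smul_measure, integral_dirac, ENNReal.toReal_ofReal (hw i), smul_eq_mul]

theorem MeasureTheory.integral_ofReal_smul_add {Ω : Type*} [MeasurableSpace Ω] {π₁ π₂ : Measure Ω}
    {f : Ω → ℝ} (h₁ : Integrable f π₁) (h₂ : Integrable f π₂) {a b : ℝ} (ha : 0 ≤ a)
    (hb : 0 ≤ b) :
    Integrable f (ENNReal.ofReal a • π₁ + ENNReal.ofReal b • π₂) ∧
      ∫ y, f y ∂(ENNReal.ofReal a • π₁ + ENNReal.ofReal b • π₂)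
        = a * ∫ y, f y ∂π₁ + b * ∫ y, f y ∂π₂ := by
  have h3 := h₁.smul_measure (c := ENNReal.ofReal a) ENNReal.ofReal_ne_top
  have h4 := h₂.smul_measure (c := ENNReal.ofReal b) ENNReal.ofReal_ne_top
  refine ⟨h3.add_measure h4, ?_⟩
  rw [integral_add_measure h3 h4, integral_smul_measure, integral_smul_measure,
    ENNReal.toReal_ofReal ha, ENNReal.toReal_ofReal hb, smul_eq_mul, smul_eq_mul]

namespace OutlierRobust

variable {d : ℕ} {Z : Set (EuclideanSpace ℝ (Fin d))}

/-- The transport plans from a trimmed version of `μ` for which all the integrals of the model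
are finite. -/
structure IsTrimmedPlan (p ε : ℝ) (μ : Measure Z) (l : Z → ℝ) (z₀ : EuclideanSpace ℝ (Fin d))
    (π : Measure (Z × Z)) : Prop where
  prob : IsProbabilityMeasure π
  fst_le : π.map Prod.fst ≤ ENNReal.ofReal (1 / (1 - ε)) • μ
  integrable_entry : ∀ i j, Integrable (fun w : Z × Z =>
    ((w.2 : EuclideanSpace ℝ (Fin d)) i - z₀ i) * ((w.2 : EuclideanSpace ℝ (Fin d)) j - z₀ j)) π
  integrable_cost : Integrable (fun w : Z × Z => ‖(w.1 : EuclideanSpace ℝ (Fin d)) - w.2‖ ^ p) π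
  integrable_loss : Integrable (fun w : Z × Z => l w.2) π

/-- The second moments, the transport cost and the expected loss of a transport plan. -/
noncomputable def planMoments (p : ℝ) (l : Z → ℝ) (z₀ : EuclideanSpace ℝ (Fin d)) (π : Measure (Z × Z)) :
    (Fin d → Fin d → ℝ) × ℝ × ℝ :=
  (fun i j => ∫ w : Z × Z, ((w.2 : EuclideanSpace ℝ (Fin d)) i - z₀ i) *
    ((w.2 : EuclideanSpace ℝ (Fin d)) j - z₀ j) ∂π,
    ∫ w : Z × Z, ‖(w.1 : EuclideanSpace ℝ (Fin d)) - w.2‖ ^ p ∂π, ∫ w : Z × Z, l w.2 ∂π)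

theorem convex_planMoments (p ε : ℝ) (μ : Measure Z) (l : Z → ℝ)
    (z₀ : EuclideanSpace ℝ (Fin d)) :
    Convex ℝ (planMoments p l z₀ '' {π | IsTrimmedPlan p ε μ l z₀ π}) := by
  rintro _ ⟨π₁, h₁, rfl⟩ _ ⟨π₂, h₂, rfl⟩ a b ha hb hab
  have hab' : ENNReal.ofReal a + ENNReal.ofReal b = 1 := by
    rw [← ENNReal.ofReal_add ha hb, hab, ENNReal.ofReal_one]
  have hp1 := h₁.prob
  have hp2 := h₂.prob
  refine ⟨ENNReal.ofReal a • π₁ + ENNReal.ofReal b • π₂, ⟨⟨?_⟩, ?_, fun i j => ?_, ?_, ?_⟩, ?_⟩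
  · simp [hab']
  · rw [Measure.map_add _ _ measurable_fst, Measure.map_smul, Measure.map_smul]
    calc ENNReal.ofReal a • π₁.map Prod.fst + ENNReal.ofReal b • π₂.map Prod.fst
        ≤ ENNReal.ofReal a • (ENNReal.ofReal (1 / (1 - ε)) • μ)
          + ENNReal.ofReal b • (ENNReal.ofReal (1 / (1 - ε)) • μ) := by
          gcongr
          · exact h₁.fst_le
          · exact h₂.fst_le
      _ = ENNReal.ofReal (1 / (1 - ε)) • μ := by rw [← add_smul, hab', one_smul]
  · exact (integral_ofReal_smul_add (h₁.integrable_entry i j) (h₂.integrable_entry i j) ha hb).1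
  · exact (integral_ofReal_smul_add h₁.integrable_cost h₂.integrable_cost ha hb).1
  · exact (integral_ofReal_smul_add h₁.integrable_loss h₂.integrable_loss ha hb).1
  · refine Prod.ext (funext fun i => funext fun j => ?_) (Prod.ext ?_ ?_)
    · exact (integral_ofReal_smul_add (h₁.integrable_entry i j) (h₂.integrable_entry i j) ha hb).2
    · exact (integral_ofReal_smul_add h₁.integrable_cost h₂.integrable_cost ha hb).2
    · exact (integral_ofReal_smul_add h₁.integrable_loss h₂.integrable_loss ha hb).2

theorem measurable_entry (z₀ : EuclideanSpace ℝ (Fin d)) (i j : Fin d) :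
    Measurable fun z : Z => ((z : EuclideanSpace ℝ (Fin d)) i - z₀ i) *
      ((z : EuclideanSpace ℝ (Fin d)) j - z₀ j) := by
  have h : ∀ k : Fin d, Measurable fun z : Z => (z : EuclideanSpace ℝ (Fin d)) k := fun k =>
    ((EuclideanSpace.proj (𝕜 := ℝ) k).continuous.measurable).comp measurable_subtype_coe
  exact ((h i).sub_const _).mul ((h j).sub_const _)

/-- A plan obeying the moment and the cost bound has a feasible second marginal. -/
theorem IsTrimmedPlan.feasible {p ε ρ σ : ℝ} (hp : 1 ≤ p) (hρ : 0 ≤ ρ) {μ : Measure Z} {l : Z → ℝ}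
    (hl : Measurable l) {z₀ : EuclideanSpace ℝ (Fin d)} {π : Measure (Z × Z)}
    (h : IsTrimmedPlan p ε μ l z₀ π)
    (hM : ∀ x : Fin d → ℝ, x ⬝ᵥ (Matrix.of (planMoments p l z₀ π).1 *ᵥ x) ≤ σ ^ 2 * (x ⬝ᵥ x))
    (hC : (planMoments p l z₀ π).2.1 ≤ ρ ^ p) :
    (π.map Prod.snd ∈ Gcov Z σ z₀ ∧
      robustWasserstein p ε μ (π.map Prod.snd) ≤ ENNReal.ofReal ρ) ∧
      expect (π.map Prod.snd) l = (((planMoments p l z₀ π).2.2 : ℝ) : EReal) := by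
  have hπ := h.prob
  have hν : IsProbabilityMeasure (π.map Prod.snd) :=
    Measure.isProbabilityMeasure_map measurable_snd.aemeasurable
  have hentry : ∀ i j, Integrable (fun z : Z => ((z : EuclideanSpace ℝ (Fin d)) i - z₀ i) *
      ((z : EuclideanSpace ℝ (Fin d)) j - z₀ j)) (π.map Prod.snd) := fun i j =>
    (integrable_map_measure (measurable_entry z₀ i j).aestronglyMeasurable
      measurable_snd.aemeasurable).2 (h.integrable_entry i j)
  have hsm : secondMoment z₀ (π.map Prod.snd) = Matrix.of (planMoments p l z₀ π).1 := by
    ext i j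
    exact integral_map measurable_snd.aemeasurable
      (measurable_entry z₀ i j).aestronglyMeasurable
  refine ⟨⟨⟨hν, ?_, ?_⟩, ?_⟩, ?_⟩
  · have h1 : MemLp (fun z : Z => (z : EuclideanSpace ℝ (Fin d)) - z₀) 2 (π.map Prod.snd) := by
      rw [memLp_two_iff_integrable_sq_norm
        (measurable_subtype_coe.sub_const z₀).aestronglyMeasurable]
      simp only [EuclideanSpace.real_norm_sq_eq, PiLp.sub_apply]
      simp only [sq]
      exact integrable_finsetSum _ fun i _ => hentry i i
    have h2 := h1.add (memLp_const z₀)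
    refine h2.congr_norm measurable_subtype_coe.aestronglyMeasurable
      (Filter.Eventually.of_forall fun z => ?_)
    simp
  · rw [Matrix.posSemidef_iff_dotProduct_mulVec]
    constructor
    · ext i j
      simp only [Matrix.conjTranspose_apply, Matrix.sub_apply, Matrix.smul_apply, star_trivial,
        Matrix.one_apply, eq_comm (a := j), secondMoment_comm z₀ _ j i]
    · intro x
      rw [hsm, Matrix.sub_mulVec, Matrix.smul_mulVec, Matrix.one_mulVec, dotProduct_sub,
        dotProduct_smul, star_trivial, smul_eq_mul]
      linarith [hM x]
  · refine robustWasserstein_le_of_coupling hp hρ π h.fst_le ?_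
    rw [← ofReal_integral_eq_lintegral_ofReal h.integrable_cost
      (Filter.Eventually.of_forall fun w => by positivity)]
    exact ENNReal.ofReal_le_ofReal hC
  · rw [expect_eq_integral ((integrable_map_measure hl.aestronglyMeasurable
      measurable_snd.aemeasurable).2 h.integrable_loss),
      integral_map measurable_snd.aemeasurable hl.aestronglyMeasurable]
    rfl

theorem integrable_empirical {n : ℕ} (hn : 0 < n) (pts : Fin n → Z) (f : Z → ℝ) :
    Integrable f (empirical pts) := by
  refine Integrable.smul_measure ?_ (ENNReal.inv_ne_top.2 (by exact_mod_cast hn.ne'))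
  exact integrable_finsetSum_measure.2 fun i _ => integrable_dirac (by simp)

theorem lintegral_empirical {n : ℕ} (pts : Fin n → Z) (f : Z → ℝ≥0∞) :
    ∫⁻ z, f z ∂(empirical pts) = (n : ℝ≥0∞)⁻¹ * ∑ i, f (pts i) := by
  rw [empirical, lintegral_smul_measure, lintegral_finsetSum_measure, smul_eq_mul]
  simp only [lintegral_dirac]

/-- A Slater point can be chosen with a finite expected loss. -/
theorem exists_slater_plan {p ε ρ σ : ℝ} (hp : 1 ≤ p) {n : ℕ} (hn : 0 < n) (pts : Fin n → Z)
    {l : Z → ℝ} (hl : Measurable l) {z₀ : EuclideanSpace ℝ (Fin d)}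
    (hS : SlaterCondition p ε ρ σ (empirical pts) z₀) :
    ∃ π : Measure (Z × Z), IsTrimmedPlan p ε (empirical pts) l z₀ π ∧
      (∀ x : Fin d → ℝ, x ≠ 0 →
        x ⬝ᵥ (Matrix.of (planMoments p l z₀ π).1 *ᵥ x) < σ ^ 2 * (x ⬝ᵥ x)) ∧
      (planMoments p l z₀ π).2.1 < ρ ^ p := by
  classical
  have hp0 : 0 < p := by linarith
  obtain ⟨hρ, ν₀, hν₀, hW, hF, hPD⟩ := hS
  obtain ⟨π, hπ, hfst, hsnd, hcost⟩ := exists_coupling_of_robustWasserstein_lt hp hρ.le hW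
  -- The first marginal is dominated by a multiple of a finitely supported measure, so every
  -- function of the source point is integrable.
  have hfin : ∀ f : Z → ℝ, Integrable f (π.map Prod.fst) := fun f =>
    ((integrable_empirical hn pts f).smul_measure ENNReal.ofReal_ne_top).mono_measure hfst
  have hfin' : ∀ f : Z → ℝ, Integrable (fun w : Z × Z => f w.1) π := fun f =>
    (hfin f).comp_measurable measurable_fst
  set S : ℕ → Set Z := fun k => {z | |l z| ≤ k} with hSdef
  have hSm : ∀ k, MeasurableSet (S k) := fun k => measurableSet_le hl.abs measurable_const
  -- Mass whose destination has `|l| > k` stays at its source. This makes the loss integrable, does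
  -- not raise the cost, and changes the second moments by an amount vanishing as `k → ∞`.
  set g : ℕ → Z × Z → Z := fun k w => if w.2 ∈ S k then w.2 else w.1 with hg
  have hgm : ∀ k, Measurable (g k) := fun k =>
    Measurable.ite (measurable_snd (hSm k)) measurable_snd measurable_fst
  set G : ℕ → Z × Z → Z × Z := fun k w => (w.1, g k w) with hG
  have hGm : ∀ k, Measurable (G k) := fun k => measurable_fst.prodMk (hgm k)
  have hgcases : ∀ k w, g k w = w.2 ∨ g k w = w.1 := by
    intro k w
    simp only [hg]
    split_ifs <;> simp
  set e : Fin d → Fin d → Z → ℝ := fun i j z => ((z : EuclideanSpace ℝ (Fin d)) i - z₀ i) *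
      ((z : EuclideanSpace ℝ (Fin d)) j - z₀ j) with he
  have hem : ∀ i j, Measurable (e i j) := measurable_entry z₀
  have hei : ∀ i j, Integrable (fun w : Z × Z => e i j w.2) π := fun i j =>
    (hsnd ▸ hF.integrable_mul z₀ i j : Integrable (e i j) (π.map Prod.snd)).comp_measurable
      measurable_snd
  have hbound : ∀ i j, Integrable (fun w : Z × Z => |e i j w.2| + |e i j w.1|) π := fun i j =>
    (hei i j).abs.add (hfin' fun z => |e i j z|)
  have hbound_le : ∀ i j k w, ‖e i j (g k w)‖ ≤ |e i j w.2| + |e i j w.1| := by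
    intro i j k w
    rw [Real.norm_eq_abs]
    rcases hgcases k w with h | h <;> rw [h]
    · linarith [abs_nonneg (e i j w.1)]
    · linarith [abs_nonneg (e i j w.2)]
  have hgi : ∀ i j k, Integrable (fun w : Z × Z => e i j (g k w)) π := fun i j k =>
    (hbound i j).mono' ((hem i j).comp (hgm k)).aestronglyMeasurable
      (Filter.Eventually.of_forall (hbound_le i j k))
  have hci : Integrable (fun w : Z × Z => ‖(w.1 : EuclideanSpace ℝ (Fin d)) - w.2‖ ^ p) π := by
    refine ⟨(measurable_cost p).aestronglyMeasurable, ?_⟩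
    rw [hasFiniteIntegral_iff_ofReal (Filter.Eventually.of_forall fun w => by positivity)]
    exact hcost.trans ENNReal.ofReal_lt_top
  have hcv : ∫ w : Z × Z, ‖(w.1 : EuclideanSpace ℝ (Fin d)) - w.2‖ ^ p ∂π < ρ ^ p := by
    rw [← ENNReal.ofReal_lt_ofReal_iff (by positivity), ofReal_integral_eq_lintegral_ofReal hci
      (Filter.Eventually.of_forall fun w => by positivity)]
    exact hcost
  have hcle : ∀ k (w : Z × Z), ‖(w.1 : EuclideanSpace ℝ (Fin d)) - g k w‖ ^ p
      ≤ ‖(w.1 : EuclideanSpace ℝ (Fin d)) - w.2‖ ^ p := by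
    intro k w
    rcases hgcases k w with h | h <;> rw [h]
    rw [sub_self, norm_zero, Real.zero_rpow hp0.ne']
    positivity
  have hcgi : ∀ k, Integrable
      (fun w : Z × Z => ‖(w.1 : EuclideanSpace ℝ (Fin d)) - g k w‖ ^ p) π := fun k =>
    hci.mono' ((measurable_cost p).comp (hGm k)).aestronglyMeasurable
      (Filter.Eventually.of_forall fun w => by
        rw [Real.norm_of_nonneg (by positivity)]
        exact hcle k w)
  have hli : ∀ k, Integrable (fun w : Z × Z => l (g k w)) π := fun k =>
    ((integrable_const (k : ℝ)).add (hfin' fun z => |l z|)).mono'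
      (hl.comp (hgm k)).aestronglyMeasurable
      (Filter.Eventually.of_forall fun w => by
        simp only [Real.norm_eq_abs, hg, Pi.add_apply]
        split_ifs with hw
        · have : |l w.2| ≤ k := hw
          linarith [abs_nonneg (l w.1)]
        · linarith [(Nat.cast_nonneg k : (0 : ℝ) ≤ k)])
  have htend : Filter.Tendsto (fun k => fun i j => ∫ w, e i j (g k w) ∂π) Filter.atTop
      (nhds fun i j => ∫ w, e i j w.2 ∂π) := by
    refine tendsto_pi_nhds.2 fun i => tendsto_pi_nhds.2 fun j => ?_
    refine tendsto_integral_of_dominated_convergence _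
      (fun k => ((hem i j).comp (hgm k)).aestronglyMeasurable) (hbound i j)
      (fun k => Filter.Eventually.of_forall (hbound_le i j k))
      (Filter.Eventually.of_forall fun w => ?_)
    refine tendsto_const_nhds.congr' ?_
    obtain ⟨k₀, hk₀⟩ := exists_nat_ge |l w.2|
    filter_upwards [Filter.eventually_ge_atTop k₀] with k hk
    have : w.2 ∈ S k := hk₀.trans (Nat.cast_le.2 hk)
    simp only [hg, if_pos this]
  have hlim : (fun i j => ∫ w, e i j w.2 ∂π) ∈ {N : Fin d → Fin d → ℝ |
      ∀ x : Fin d → ℝ, x ≠ 0 → x ⬝ᵥ (Matrix.of N *ᵥ x) < σ ^ 2 * (x ⬝ᵥ x)} := by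
    intro x hx
    have h1 : Matrix.of (fun i j => ∫ w, e i j w.2 ∂π) = secondMoment z₀ ν₀ := by
      ext i j
      rw [← hsnd]
      exact (integral_map measurable_snd.aemeasurable (hem i j).aestronglyMeasurable).symm
    have h2 := (Matrix.posDef_iff_dotProduct_mulVec.1 hPD).2 hx
    rw [Matrix.sub_mulVec, Matrix.smul_mulVec, Matrix.one_mulVec, dotProduct_sub,
      dotProduct_smul, star_trivial, smul_eq_mul] at h2
    rw [h1]
    linarith
  obtain ⟨k, hk⟩ := (htend.eventually ((isOpen_setOf_quadratic_lt (σ ^ 2)).mem_nhds hlim)).exists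
  have hGp : IsProbabilityMeasure (π.map (G k)) :=
    Measure.isProbabilityMeasure_map (hGm k).aemeasurable
  refine ⟨π.map (G k), ⟨hGp, ?_, fun i j => ?_, ?_, ?_⟩, ?_, ?_⟩
  · rw [Measure.map_map measurable_fst (hGm k)]
    exact hfst
  · exact (integrable_map_measure ((hem i j).comp measurable_snd).aestronglyMeasurable
      (hGm k).aemeasurable).2 (hgi i j k)
  · exact (integrable_map_measure (measurable_cost p).aestronglyMeasurable
      (hGm k).aemeasurable).2 (hcgi k)
  · exact (integrable_map_measure (hl.comp measurable_snd).aestronglyMeasurable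
      (hGm k).aemeasurable).2 (hli k)
  · have h1 : (planMoments p l z₀ (π.map (G k))).1 = fun i j => ∫ w, e i j (g k w) ∂π := by
      funext i j
      exact integral_map (hGm k).aemeasurable
        ((hem i j).comp measurable_snd).aestronglyMeasurable
    rw [h1]
    exact hk
  · have h1 : (planMoments p l z₀ (π.map (G k))).2.1
        = ∫ w : Z × Z, ‖(w.1 : EuclideanSpace ℝ (Fin d)) - g k w‖ ^ p ∂π :=
      integral_map (hGm k).aemeasurable (measurable_cost p).aestronglyMeasurable
    rw [h1]
    exact (integral_mono (hcgi k) hci (hcle k)).trans_lt hcv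

/-- The plan moving the share `wᵢ` of the `i`-th sample point to `ξᵢ`. -/
theorem isTrimmedPlan_sum_dirac {p ε : ℝ} (hε₁ : ε < 1) {n : ℕ} (hn : 0 < n) (pts : Fin n → Z)
    (l : Z → ℝ) (z₀ : EuclideanSpace ℝ (Fin d)) {w : Fin n → ℝ} (hw0 : ∀ i, 0 ≤ w i)
    (hw1 : ∀ i, w i ≤ 1 / (1 - ε) / n) (hsum : ∑ i, w i = 1) (ξ : Fin n → Z) :
    IsTrimmedPlan p ε (empirical pts) l z₀
      (∑ i, ENNReal.ofReal (w i) • Measure.dirac (pts i, ξ i)) := by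
  have hc : (0 : ℝ) < 1 / (1 - ε) := one_div_pos.2 (by linarith)
  refine ⟨⟨?_⟩, ?_, fun i j => (integral_sum_smul_dirac hw0 _ _).1,
    (integral_sum_smul_dirac hw0 _ _).1, (integral_sum_smul_dirac hw0 _ _).1⟩
  · simp only [Measure.coe_finsetSum, Finset.sum_apply, Measure.smul_apply, measure_univ,
      smul_eq_mul, mul_one]
    rw [← ENNReal.ofReal_sum_of_nonneg fun i _ => hw0 i, hsum, ENNReal.ofReal_one]
  · refine Measure.le_iff.2 fun s hs => ?_
    rw [Measure.map_apply measurable_fst hs]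
    simp only [empirical, Measure.coe_finsetSum, Finset.sum_apply, Measure.smul_apply,
      smul_eq_mul, Finset.mul_sum]
    refine Finset.sum_le_sum fun i _ => ?_
    rw [Measure.dirac_apply' _ (measurable_fst hs), Measure.dirac_apply' _ hs, ← mul_assoc]
    refine mul_le_mul' ?_ le_rfl
    refine (ENNReal.ofReal_le_ofReal (hw1 i)).trans_eq ?_
    rw [div_eq_mul_inv _ (n : ℝ), ENNReal.ofReal_mul hc.le,
      ENNReal.ofReal_inv_of_pos (by exact_mod_cast hn), ENNReal.ofReal_natCast]

/-- Strong duality: a bound on the primal problem is attained by the dual problem. -/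
theorem exists_dualObjective_le {p ε ρ σ : ℝ} (hp : 1 ≤ p) (hε₀ : 0 ≤ ε) (hε₁ : ε < 1)
    {n : ℕ} (hn : 0 < n) (pts : Fin n → Z) {l : Z → ℝ} (hl : Measurable l)
    {z₀ : EuclideanSpace ℝ (Fin d)} (hS : SlaterCondition p ε ρ σ (empirical pts) z₀) {B : ℝ}
    (hB : ∀ ν : Measure Z, ν ∈ Gcov Z σ z₀ →
      robustWasserstein p ε (empirical pts) ν ≤ ENNReal.ofReal ρ → expect ν l ≤ B) :
    ∃ Λ : Matrix (Fin d) (Fin d) ℝ, Λ.PosSemidef ∧ ∃ lam : ℝ, 0 ≤ lam ∧ ∃ α : ℝ,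
      dualObjective p ε ρ σ (empirical pts) l z₀ Λ lam α ≤ B := by
  have hρ : 0 < ρ := hS.1
  have hn' : (0 : ℝ) < n := by exact_mod_cast hn
  have hc1 : (1 : ℝ) ≤ 1 / (1 - ε) := by
    rw [le_div_iff₀ (by linarith)]
    linarith
  have hc : (0 : ℝ) < 1 / (1 - ε) := by linarith
  obtain ⟨Λ, hΛ, lam, hlam, hmult⟩ := exists_matrix_multiplier
    (convex_planMoments p ε (empirical pts) l z₀) (s := σ ^ 2) (R := ρ ^ p) (B := B)
    (by
      rintro _ ⟨π, hπ, rfl⟩ hM hC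
      obtain ⟨⟨h1, h2⟩, h3⟩ := hπ.feasible hp hρ.le hl hM hC
      have := hB _ h1 h2
      rwa [h3, EReal.coe_le_coe_iff] at this)
    (by
      obtain ⟨π, h1, h2, h3⟩ := exists_slater_plan hp hn pts hl hS
      exact ⟨_, ⟨π, h1, rfl⟩, h2, h3⟩)
  set h : Fin n → Z → ℝ := fun i ξ => l ξ - bil Λ (ξ - z₀) (ξ - z₀)
    - lam * ‖(pts i : EuclideanSpace ℝ (Fin d)) - ξ‖ ^ p with hh
  set B' := B - σ ^ 2 * Λ.trace - lam * ρ ^ p with hB'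
  -- The multiplier inequality on plans with one destination per sample point, with the terms
  -- independent of the plan moved into `B'`.
  have hw : ∀ w : Fin n → ℝ, (∀ i, 0 ≤ w i) → (∀ i, w i ≤ 1 / (1 - ε) / n) → ∑ i, w i = 1 →
      ∀ ξ : Fin n → Z, ∑ i, w i * h i (ξ i) ≤ B' := by
    intro w hw0 hw1 hsum ξ
    have h1 := hmult _ ⟨_, isTrimmedPlan_sum_dirac hε₁ hn pts l z₀ hw0 hw1 hsum ξ, rfl⟩
      (fun i j => by simp only [planMoments, mul_comm])
    simp only [planMoments, (integral_sum_smul_dirac hw0 _ _).2] at h1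
    have h2 : ∑ i, w i * bil Λ (ξ i - z₀) (ξ i - z₀) = ∑ a, ∑ b, Λ a b * ∑ i, w i *
        (((ξ i : EuclideanSpace ℝ (Fin d)) a - z₀ a) *
          ((ξ i : EuclideanSpace ℝ (Fin d)) b - z₀ b)) := by
      simp only [bil_eq_sum, Finset.mul_sum, PiLp.sub_apply]
      rw [Finset.sum_comm]
      refine Finset.sum_congr rfl fun a _ => ?_
      rw [Finset.sum_comm]
      exact Finset.sum_congr rfl fun b _ => Finset.sum_congr rfl fun i _ => by ring
    have h3 : ∑ i, w i * h i (ξ i) = ∑ i, w i * l (ξ i)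
        - ∑ i, w i * bil Λ (ξ i - z₀) (ξ i - z₀)
        - lam * ∑ i, w i * ‖(pts i : EuclideanSpace ℝ (Fin d)) - ξ i‖ ^ p := by
      rw [Finset.mul_sum, ← Finset.sum_sub_distrib, ← Finset.sum_sub_distrib]
      exact Finset.sum_congr rfl fun i _ => by simp only [hh]; ring
    rw [h3, h2]
    linarith
  have hne : Nonempty Z := ⟨pts ⟨0, hn⟩⟩
  have hbdd : ∀ i, BddAbove (Set.range (h i)) := by
    intro i
    -- Uniform weights `1/n` respect the cap because `1/(1-ε) ≥ 1`. Keeping every other sample point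
    -- in place isolates `h i ξ`.
    refine ⟨n * (B' - ∑ j ∈ Finset.univ.erase i, 1 / (n : ℝ) * h j (pts j)), ?_⟩
    rintro _ ⟨ξ, rfl⟩
    have h1 := hw (fun _ => 1 / n) (fun _ => by positivity)
      (fun _ => div_le_div_of_nonneg_right hc1 hn'.le)
      (by simp [hn'.ne']) (Function.update pts i ξ)
    rw [← Finset.add_sum_erase _ _ (Finset.mem_univ i), Function.update_self,
      Finset.sum_congr rfl fun j hj => by
        rw [Function.update_of_ne (Finset.ne_of_mem_erase hj)]] at h1
    rw [← div_le_iff₀' hn']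
    have : h i ξ / n = 1 / (n : ℝ) * h i ξ := by ring
    linarith
  set φ : Fin n → ℝ := fun i => ⨆ ξ, h i ξ with hφ
  obtain ⟨α, w, hw0, hw1, hsum, hα⟩ := exists_weights_eq_threshold (1 / (1 - ε) / n)
    (by positivity) (by
      rw [Fintype.card_fin, div_mul_cancel₀ _ hn'.ne']
      exact hc1) φ
  have hφB : ∑ i, w i * φ i ≤ B' := by
    refine le_of_forall_pos_sub_le fun η hη => ?_
    have h1 : ∀ i, ∃ ξ, φ i - η < h i ξ := fun i => exists_lt_of_lt_ciSup (by linarith)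
    choose ξ hξ using h1
    have h2 := hw w hw0 hw1 hsum ξ
    have h3 : ∑ i, w i * (φ i - η) ≤ ∑ i, w i * h i (ξ i) :=
      Finset.sum_le_sum fun i _ => mul_le_mul_of_nonneg_left (hξ i).le (hw0 i)
    simp only [mul_sub, Finset.sum_sub_distrib] at h3
    rw [← Finset.sum_mul, hsum, one_mul] at h3
    linarith
  -- The shift by `z₀ᵀΛz₀` compensates for `lbar` omitting the constant term of `(ξ - z₀)ᵀΛ(ξ -
  -- z₀)`.
  refine ⟨Λ, hΛ, lam, hlam, α + bil Λ z₀ z₀, ?_⟩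
  have hlbar : ∀ i, lbar p l z₀ Λ lam (α + bil Λ z₀ z₀) (pts i)
      ≤ ENNReal.ofReal (max (φ i - α) 0) := by
    intro i
    refine iSup_le fun ξ => ENNReal.ofReal_le_ofReal (le_max_of_le_left ?_)
    have h1 : h i ξ ≤ φ i := le_ciSup (hbdd i) ξ
    simp only [hh] at h1
    rw [bil_sub_self hΛ, norm_sub_rev] at h1
    linarith
  have hint : ENNReal.ofReal (1 / (1 - ε)) *
      ∫⁻ z, lbar p l z₀ Λ lam (α + bil Λ z₀ z₀) z ∂(empirical pts)
      ≤ ENNReal.ofReal (1 / (1 - ε) / n * ∑ i, max (φ i - α) 0) := by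
    rw [lintegral_empirical, div_eq_mul_inv _ (n : ℝ), mul_assoc, ENNReal.ofReal_mul hc.le,
      ENNReal.ofReal_mul (by positivity), ENNReal.ofReal_inv_of_pos hn', ENNReal.ofReal_natCast,
      ENNReal.ofReal_sum_of_nonneg fun i _ => le_max_right _ _]
    gcongr with i
    exact hlbar i
  have hnn : 0 ≤ 1 / (1 - ε) / n * ∑ i, max (φ i - α) 0 :=
    mul_nonneg (by positivity) (Finset.sum_nonneg fun i _ => le_max_right _ _)
  calc dualObjective p ε ρ σ (empirical pts) l z₀ Λ lam (α + bil Λ z₀ z₀)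
      ≤ ((-bil Λ z₀ z₀ + σ ^ 2 * Λ.trace + lam * ρ ^ p + (α + bil Λ z₀ z₀) : ℝ) : EReal)
        + ((ENNReal.ofReal (1 / (1 - ε) / n * ∑ i, max (φ i - α) 0) : ℝ≥0∞) : EReal) := by
        rw [dualObjective]
        gcongr
        exact EReal.coe_ennreal_le_coe_ennreal_iff.2 hint
    _ ≤ B := by
        rw [EReal.coe_ennreal_ofReal, max_eq_left hnn, ← EReal.coe_add, EReal.coe_le_coe_iff]
        linarith

end OutlierRobust

theorem mainTheorem10 {d n : ℕ} (hn : 0 < n)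
    (Z : Set (EuclideanSpace ℝ (Fin d))) (hZ : IsClosed Z)
    (p ε ρ σ : ℝ) (hp : 1 ≤ p) (hε₀ : 0 ≤ ε) (hε₁ : ε < 1)
    (pts : Fin n → Z) (z₀ : EuclideanSpace ℝ (Fin d))
    (hSlater : OutlierRobust.SlaterCondition p ε ρ σ (OutlierRobust.empirical pts) z₀)
    (l : Z → ℝ) (hl : OutlierRobust.AdmissibleLoss p l) :
    (⨆ ν ∈ {ν : Measure Z | ν ∈ OutlierRobust.Gcov Z σ z₀ ∧
        OutlierRobust.robustWasserstein p ε (OutlierRobust.empirical pts) ν ≤ ENNReal.ofReal ρ},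
      OutlierRobust.expect ν l) =
    ⨅ (Λ : Matrix (Fin d) (Fin d) ℝ) (_ : Λ.PosSemidef) (lam : ℝ) (_ : 0 ≤ lam) (α : ℝ),
      OutlierRobust.dualObjective p ε ρ σ (OutlierRobust.empirical pts) l z₀ Λ lam α := by
  have hlm : Measurable l := hl.1.measurable
  refine le_antisymm ?_ ?_
  · exact iSup₂_le fun ν hν => le_iInf fun Λ => le_iInf fun hΛ => le_iInf fun lam =>
      le_iInf fun hlam => le_iInf fun α =>
        OutlierRobust.expect_le_dualObjective hp hε₁ hSlater.1 hlm hν.1 hν.2 hΛ hlam α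
  -- Comparing with real `B` above the supremum avoids separate treatment of infinite primal values.
  · refine EReal.le_of_forall_lt_iff_le.1 fun B hB => ?_
    obtain ⟨Λ, hΛ, lam, hlam, α, h⟩ :=
      OutlierRobust.exists_dualObjective_le hp hε₀ hε₁ hn pts hlm hSlater (B := B)
        fun ν h1 h2 => (le_iSup₂_of_le ν ⟨h1, h2⟩ le_rfl).trans hB.le
    exact iInf_le_of_le Λ <| iInf_le_of_le hΛ <| iInf_le_of_le lam <| iInf_le_of_le hlam <|
      iInf_le_of_le α h
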